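/- **Setting.** Fix an integer $k\ge 1$, a real $\mu\ge 10(k+1)$ and a real $C>0$. A *$k$-bow-free causal graph* on $V=\{1,\dots,n\}$ is a mixed graph with directed and bidirected edges such that the directed edges form an acyclic graph, no two vertices are joined by both a directed and a bidirected edge, and every vertex has in-degree and out-degree at most $k$ (in the directed edges). Write $\mathrm{pa}(v)$ for the set of parents of $v$ and $\mathrm{spa}(v)=\mathrm{pa}(\mathrm{pa}(v))$ for the set of parents of parents of $v$. For a matrix $M$ and index sets $I,J$ let $M_{I,J}$ be the corresponding sub-matrix, $\|M\|$ the spectral norm, and $\kappa(M)=\|M^{-1}\|\,\|M\|$ for invertible $M$. **Generative model.** Given such a graph and a dimension $d$, the random matrix $\Lambda\in\mathbb R^{n\times n}$ has $\Lambda_{u,v}=0$ unless $u\to v$ is a directed edge, and the entries on the directed edges are i.i.d. uniform on $[-\frac1{2k\mu},\frac1{2k\mu}]\setminus[-\frac1{n^2},\frac1{n^2}]$. Random unit vectors $x_1,\dots,x_n\in\mathbb R^d$ are generated one after the other along a topological order of the directed graph, $x_i$ being a uniform unit vector of the subspace orthogonal to $\{x_j : j\in\mathrm{pa}(i)\}$;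 that is, for independent uniform unit vectors $y_1,\dots,y_n$ of $\mathbb R^d$, $x_i=p_i/\|p_i\|$ (and $x_i=0$ if $p_i=0$), where $p_i$ is the orthogonal projection of $y_i$ onto $\mathrm{span}\{x_j: j\in\mathrm{pa}(i)\}^\perp$. Put $\Omega_{i,j}=\langle x_i,x_j\rangle$ and $\Sigma=(I-\Lambda)^{-T}\,\Omega\,(I-\Lambda)^{-1}$. **Theorem.** Let $\beta=1/\mu$. There are sequences $\alpha=\alpha_n$ and $\kappa_0=\kappa_{0,n}$, depending only on $k,\mu,C$, with $$\alpha=\frac1\mu+o(1),\qquad \kappa_0=\Big(\frac{1+\mu}{\mu}\Big)^4+\frac{(\mu+1)^2}{5\mu^2(\mu-1)}+o(1)\qquad(n\to\infty),$$ such that for every $c\in\mathbb N$ there is $N$ such that for all $n\ge N$, all $d\ge C\,k^8\log^4 n$ and every $k$-bow-free causal graph on $n$ vertices, with probability at least $1-n^{-c}$ the following hold simultaneously. 1. (A.1) For every $v\in V$, $\Sigma_{\mathrm{pa}(v),\mathrm{pa}(v)}$ is invertible and $\kappa(\Sigma_{\mathrm{pa}(v),\mathrm{pa}(v)})\le\kappa_0$.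 2. (A.2) For every $v\in V$: $\|\Sigma_{\mathrm{pa}(v),\{v\}}\|\le\alpha\|\Sigma_{\mathrm{pa}(v),\mathrm{pa}(v)}\|$ and $\|\Sigma_{\mathrm{spa}(v),\{v\}}\|\le\alpha\|\Sigma_{\mathrm{pa}(v),\mathrm{pa}(v)}\|$; moreover $\|\Sigma_{\mathrm{spa}(v)\setminus\mathrm{pa}(v),\,\mathrm{pa}(v)}\|\le\alpha\|\Sigma_{\mathrm{pa}(v),\mathrm{pa}(v)}\|$, so that $\|\Sigma_{\mathrm{spa}(v),\mathrm{pa}(v)}\|\le\alpha\|\Sigma_{\mathrm{pa}(v),\mathrm{pa}(v)}\|$ whenever $\mathrm{spa}(v)\cap\mathrm{pa}(v)=\emptyset$ (for instance for every $v$ if directed edges join consecutive layers only). 3. (A.3) For every $v\in V$, $\|\Lambda_{\mathrm{spa}(v),\mathrm{pa}(v)}\|\le\beta$, and for every directed edge $u\to v$, $|\Lambda_{u,v}|\ge\frac1\lambda$ with $\lambda=n^2$. Moreover, for all $n\ge N$ these constants satisfy the numerical conditions of the robust identifiability theorem for perturbations of relative size $\gamma$: $0<\alpha<1$, $\beta<1$,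 $\kappa_0\le\frac1{2\gamma}$ for all $0<\gamma<n^{-4}$, $\alpha\beta\kappa_0<0.99$ and $$\frac{\alpha\kappa_0}{1-\alpha\beta\kappa_0}\Big(1+\frac{\kappa_0(1+\beta)}{1-\alpha\beta\kappa_0}\Big)<\frac{0.99}{k}.$$ -/

import Mathlib

open MeasureTheory ProbabilityTheory Filter Topology
open scoped Matrix Matrix.Norms.L2Operator

/-- A mixed graph on the vertices `Fin n`: directed (causal) edges and bidirected edges. -/
structure MixedGraph (n : ℕ) where
  /-- `dir u v` means that there is a directed edge `u → v`. -/
  dir : Fin n → Fin n → Prop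
  /-- `bidir u v` means that there is a bidirected edge `u ↔ v`. -/
  bidir : Fin n → Fin n → Prop
  bidir_symm : ∀ u v, bidir u v → bidir v u

namespace MixedGraph

variable {n : ℕ}

open Classical in
/-- The parents of a vertex. -/
noncomputable def pa (G : MixedGraph n) (v : Fin n) : Finset (Fin n) :=
  Finset.univ.filter (fun u => G.dir u v)

open Classical in
/-- The children of a vertex. -/
noncomputable def ch (G : MixedGraph n) (u : Fin n) : Finset (Fin n) :=
  Finset.univ.filter (fun v => G.dir u v)

/-- The parents of the parents of a vertex. -/
noncomputable def spa (G : MixedGraph n) (v : Fin n) : Finset (Fin n) :=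
  (G.pa v).biUnion G.pa

/-- `k`-bow-free causal graphs: the directed part is acyclic, no two vertices are joined by both a
directed and a bidirected edge, and all in-degrees and out-degrees are at most `k`. -/
structure IsBowFree (G : MixedGraph n) (k : ℕ) : Prop where
  acyclic : ∀ v, ¬ Relation.TransGen G.dir v v
  bow_free : ∀ u v, ¬ (G.dir u v ∧ G.bidir u v)
  indegree_le : ∀ v, (G.pa v).card ≤ k
  outdegree_le : ∀ v, (G.ch v).card ≤ k

end MixedGraph

/-- The sub-matrix with rows in `I` and columns in `J`. Norms of matrices are spectral norms
(`Matrix.Norms.L2Operator`); for a single column this is the Euclidean norm. -/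
def blk {n : ℕ} (M : Matrix (Fin n) (Fin n) ℝ) (I J : Finset (Fin n)) : Matrix I J ℝ :=
  M.submatrix Subtype.val Subtype.val

/-- The covariance matrix `(I - Λ)⁻ᵀ Ω (I - Λ)⁻¹` of the linear structural equation model. -/
noncomputable def lsemCov {n : ℕ} (L W : Matrix (Fin n) (Fin n) ℝ) : Matrix (Fin n) (Fin n) ℝ :=
  ((1 - L)⁻¹)ᵀ * W * (1 - L)⁻¹

/-- The condition number `‖M⁻¹‖ ‖M‖` in the spectral norm, for an invertible `M`. -/
noncomputable def spectralCond {ι : Type*} [Fintype ι] [DecidableEq ι] (M : Matrix ι ι ℝ) : ℝ :=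
  ‖M⁻¹‖ * ‖M‖

/-- The Gram matrix of a family of vectors. -/
noncomputable def gramMat {n d : ℕ} (x : Fin n → EuclideanSpace ℝ (Fin d)) :
    Matrix (Fin n) (Fin n) ℝ :=
  Matrix.of fun i j => inner ℝ (x i) (x j)

/-- The random weights: zero off the directed edges, and i.i.d. uniform on
`[-1/(2kμ), 1/(2kμ)] \ [-1/n², 1/n²]` on the directed edges. -/
structure IsRandomWeights {n : ℕ} (G : MixedGraph n) (k : ℕ) (μ : ℝ)
    {S : Type*} [MeasurableSpace S] (P : Measure S)
    (L : S → Matrix (Fin n) (Fin n) ℝ) : Prop where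
  measurable : ∀ u v, Measurable fun ω => L ω u v
  zero_of_not_edge : ∀ ω u v, ¬ G.dir u v → L ω u v = 0
  uniform_of_edge : ∀ u v, G.dir u v →
    pdf.IsUniform (fun ω => L ω u v)
      (Set.Icc (-(1 / (2 * k * μ))) (1 / (2 * k * μ)) \ Set.Icc (-(1 / (n : ℝ) ^ 2)) (1 / (n : ℝ) ^ 2))
      P volume
  indep : iIndepFun (fun (e : {p : Fin n × Fin n // G.dir p.1 p.2}) (ω : S) => L ω e.1.1 e.1.2) P

/-- The random vectors: every `x i` is a uniform unit vector of the subspace orthogonal to the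
vectors of the parents of `i`, generated from independent uniform unit vectors `y i` of `ℝᵈ` by
removing the component of `y i` in the span of the parents' vectors and normalizing. (As the
directed graph is acyclic, `y` determines `x`.) -/
structure IsRandomVectors {n d : ℕ} (G : MixedGraph n)
    {S : Type*} [MeasurableSpace S] (P : Measure S)
    (x : Fin n → S → EuclideanSpace ℝ (Fin d)) : Prop where
  measurable : ∀ i, Measurable (x i)
  generated : ∃ y : Fin n → S → Metric.sphere (0 : EuclideanSpace ℝ (Fin d)) 1,
    (∀ i, Measurable (y i)) ∧
    (∀ i, pdf.IsUniform (y i) Set.univ P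
      (volume : Measure (EuclideanSpace ℝ (Fin d))).toSphere) ∧
    iIndepFun y P ∧
    ∀ i ω,
      let p : EuclideanSpace ℝ (Fin d) :=
        (Submodule.span ℝ {z | ∃ j ∈ G.pa i, z = x j ω})ᗮ.starProjection (y i ω)
      x i ω = ‖p‖⁻¹ • p

/-- Input condition number: every parent block is invertible, with condition number at most
`κ₀`. -/
def AssumptionA1 {n : ℕ} (G : MixedGraph n) (Sg : Matrix (Fin n) (Fin n) ℝ) (κ₀ : ℝ) : Prop :=
  ∀ v, IsUnit (blk Sg (G.pa v) (G.pa v)).det ∧ spectralCond (blk Sg (G.pa v) (G.pa v)) ≤ κ₀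

/-- Diagonal dominance. In `spa_pa` the block is off-diagonal: this is `spa(v) × pa(v)` at the
vertices where these two sets are disjoint, and `(spa(v) \ pa(v)) × pa(v)` in general. -/
structure AssumptionA2 {n : ℕ} (G : MixedGraph n) (Sg : Matrix (Fin n) (Fin n) ℝ) (α : ℝ) :
    Prop where
  pa_self : ∀ v, ‖blk Sg (G.pa v) {v}‖ ≤ α * ‖blk Sg (G.pa v) (G.pa v)‖
  spa_pa : ∀ v, Disjoint (G.spa v) (G.pa v) →
    ‖blk Sg (G.spa v) (G.pa v)‖ ≤ α * ‖blk Sg (G.pa v) (G.pa v)‖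
  spa_sdiff_pa : ∀ v, ‖blk Sg (G.spa v \ G.pa v) (G.pa v)‖ ≤ α * ‖blk Sg (G.pa v) (G.pa v)‖
  spa_self : ∀ v, ‖blk Sg (G.spa v) {v}‖ ≤ α * ‖blk Sg (G.pa v) (G.pa v)‖

/-- Normalized parameters, with `|Λ u v| ≥ 1 / lam` on the directed edges. -/
structure AssumptionA3 {n : ℕ} (G : MixedGraph n) (L : Matrix (Fin n) (Fin n) ℝ) (β lam : ℝ) :
    Prop where
  norm_le : ∀ v, ‖blk L (G.spa v) (G.pa v)‖ ≤ β
  le_abs : ∀ u v, G.dir u v → 1 / lam ≤ |L u v|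

/-- The numerical side conditions on the constants `α, β, κ₀` under which robust identifiability
with perturbations of relative size `γ < 1 / n⁴` is guaranteed. -/
structure ConstantsAdmissible (n k : ℕ) (α β κ₀ : ℝ) : Prop where
  α_pos : 0 < α
  α_lt_one : α < 1
  β_lt_one : β < 1
  κ₀_le : ∀ γ : ℝ, 0 < γ → γ < 1 / (n : ℝ) ^ 4 → κ₀ ≤ 1 / (2 * γ)
  prod_lt : α * β * κ₀ < 0.99
  main_lt : α * κ₀ / (1 - α * β * κ₀) * (1 + κ₀ * (1 + β) / (1 - α * β * κ₀)) < 0.99 / k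

/-! Everything is deterministic on one good event: all weights lie in their range, and the
generating vectors satisfy |⟨y i, y j⟩| ≤ δ = 1/(80k²μ) for i ≠ j. The range condition holds almost
surely. A spherical cap estimate bounds the failure probability of one pair by 2 exp(-δ²d/2). Since
δ depends only on k and μ, d ≥ Ck⁸ log⁴ n makes this beat the n² pairs and any power of n.

On the good event, projecting and normalizing along the graph costs only a factor 4
(`coherence_of_generated`), because each span has at most k nearly orthonormal generators. Put h =
1/(2μ). Then |Λ u v| ≤ h/k, and the entries of Ω - 1 are at most 4δ = h/(10k²). With T = (1 - Λ)⁻¹,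
the matrix Σ - 1 is Λ + Λᵀ, plus terms of second order in Λ, plus Tᵀ(Ω - 1)T. Degree bounds and
Frobenius norms bound these on small blocks by 1.42h, 0.08h and 0.2h
(`norm_blk_lsemCov_sub_one_le`).

So every parent block is within 1.7h of the identity, which bounds its condition number and keeps
its norm at least 1 - 1.7h; blocks of Σ off the diagonal have norm at most 1.7h ≤ 2h(1 - 1.7h),
where 2h = 1/μ. Hence α and κ₀ can be taken constant, equal to their claimed limits. -/

/-! ### Concentration on the sphere -/

section SphericalCap

open scoped Pointwise

variable {E : Type*} [NormedAddCommGroup E] [InnerProductSpace ℝ E]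

/-- The cone over a spherical cap is contained in a ball of radius less than one. -/
theorem cone_cap_subset_closedBall {u : E} (hu : ‖u‖ = 1) {δ : ℝ} (hδ : 0 ≤ δ)
    (hδ2 : δ ^ 2 ≤ 1 / 2) :
    Set.Ioo (0 : ℝ) 1 • ((↑) '' {y : Metric.sphere (0 : E) 1 | δ ≤ inner ℝ u (y : E)})
      ⊆ Metric.closedBall (δ • u) (√(1 - δ ^ 2)) := by
  rintro _ ⟨t, ⟨ht0, ht1⟩, _, ⟨y, hy, rfl⟩, rfl⟩
  have hy1 : ‖(y : E)‖ = 1 := by simp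
  rw [Metric.mem_closedBall, dist_eq_norm]
  apply Real.le_sqrt_of_sq_le
  have hy' : δ ≤ inner ℝ u (y : E) := hy
  simp only
  rw [norm_sub_sq_real, norm_smul, norm_smul, inner_smul_left, inner_smul_right, hy1, hu,
    real_inner_comm, Real.norm_of_nonneg ht0.le, Real.norm_of_nonneg hδ]
  simp only [conj_trivial]
  have h1 : t * (δ * δ) ≤ t * (δ * inner ℝ u (y : E)) := by gcongr
  -- The bound t² - 2tδ² + δ² is convex in t, with value 1 - δ² at t = 1 and δ² at t = 0; the latter
  -- is where δ² ≤ 1/2 enters.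
  nlinarith [mul_nonneg ht0.le (sub_nonneg.2 ht1.le),
    mul_nonneg (sub_nonneg.2 ht1.le) (sub_nonneg.2 hδ2)]

variable [MeasurableSpace E] [BorelSpace E] [FiniteDimensional ℝ E]

/-- `toSphere` is the dimension times the volume of the cone, so scaling of Haar measure on the ball
containing the cone gives the bound. -/
theorem toSphere_cap_le (ν : Measure E) [ν.IsAddHaarMeasure]
    {u : E} (hu : ‖u‖ = 1) {δ : ℝ} (hδ : 0 ≤ δ) (hδ2 : δ ^ 2 ≤ 1 / 2) :
    ν.toSphere {y | δ ≤ inner ℝ u (y : E)} ≤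
      ENNReal.ofReal (√(1 - δ ^ 2) ^ Module.finrank ℝ E) * ν.toSphere Set.univ := by
  have hm : MeasurableSet {y : Metric.sphere (0 : E) 1 | δ ≤ inner ℝ u (y : E)} :=
    (isClosed_le continuous_const (by fun_prop)).measurableSet
  rw [ν.toSphere_apply' hm, ν.toSphere_apply_univ]
  calc _ ≤ (Module.finrank ℝ E : ENNReal) * ν (Metric.closedBall (δ • u) (√(1 - δ ^ 2))) := by
        gcongr
        exact cone_cap_subset_closedBall hu hδ hδ2
    _ = _ := by
        rw [Measure.addHaar_closedBall _ _ (Real.sqrt_nonneg _)]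
        ring

theorem sqrt_one_sub_sq_pow_le_exp (δ : ℝ) (m : ℕ) :
    √(1 - δ ^ 2) ^ m ≤ Real.exp (-(δ ^ 2 * m / 2)) := by
  have h : √(1 - δ ^ 2) ≤ Real.exp (-(δ ^ 2 / 2)) := by
    rw [Real.sqrt_le_iff]
    refine ⟨(Real.exp_pos _).le, ?_⟩
    rw [← Real.exp_nat_mul]
    have := Real.add_one_le_exp (-δ ^ 2)
    calc _ ≤ Real.exp (-δ ^ 2) := by linarith
      _ = _ := by congr 1; push_cast; ring
  calc _ ≤ Real.exp (-(δ ^ 2 / 2)) ^ m := by gcongr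
    _ = _ := by rw [← Real.exp_nat_mul]; congr 1; ring

theorem cond_toSphere_abs_inner_le [Nontrivial E] (ν : Measure E) [ν.IsAddHaarMeasure]
    {u : E} (hu : ‖u‖ = 1) {δ : ℝ} (hδ : 0 ≤ δ) (hδ2 : δ ^ 2 ≤ 1 / 2) :
    ProbabilityTheory.cond ν.toSphere Set.univ {y | δ < |inner ℝ u (y : E)|} ≤
      ENNReal.ofReal (2 * Real.exp (-(δ ^ 2 * Module.finrank ℝ E / 2))) := by
  have hcap : ∀ w : E, ‖w‖ = 1 →
      ProbabilityTheory.cond ν.toSphere Set.univ {y | δ ≤ inner ℝ w (y : E)} ≤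
      ENNReal.ofReal (Real.exp (-(δ ^ 2 * Module.finrank ℝ E / 2))) := by
    intro w hw
    rw [ProbabilityTheory.cond_apply MeasurableSet.univ, Set.univ_inter]
    calc _ ≤ (ν.toSphere Set.univ)⁻¹ *
          (ENNReal.ofReal (√(1 - δ ^ 2) ^ Module.finrank ℝ E) * ν.toSphere Set.univ) := by
          gcongr
          exact toSphere_cap_le ν hw hδ hδ2
      _ = ENNReal.ofReal (√(1 - δ ^ 2) ^ Module.finrank ℝ E) := by
          rw [mul_comm, mul_assoc, ENNReal.mul_inv_cancel, mul_one]
          · simp [-Measure.toSphere_apply_univ]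
          · exact measure_ne_top _ _
      _ ≤ _ := ENNReal.ofReal_le_ofReal (sqrt_one_sub_sq_pow_le_exp δ _)
  calc _ ≤ ProbabilityTheory.cond ν.toSphere Set.univ
        ({y | δ ≤ inner ℝ u (y : E)} ∪ {y | δ ≤ inner ℝ (-u) (y : E)}) := by
        apply measure_mono
        intro y hy
        rcases lt_abs.1 (show δ < |inner ℝ u (y : E)| from hy) with h | h
        · exact Or.inl h.le
        · right
          simpa using h.le
    _ ≤ _ := measure_union_le _ _
    _ ≤ _ := add_le_add (hcap u hu) (hcap (-u) (by simpa using hu))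
    _ = _ := by
        rw [← ENNReal.ofReal_add (Real.exp_pos _).le (Real.exp_pos _).le, two_mul]

/-- Two independent uniform unit vectors are almost orthogonal with high probability. -/
theorem measure_abs_inner_gt_le [Nontrivial E] (ν : Measure E) [ν.IsAddHaarMeasure]
    {S : Type*} [MeasurableSpace S] (P : Measure S) [IsProbabilityMeasure P]
    {y z : S → Metric.sphere (0 : E) 1} (hy : Measurable y) (hz : Measurable z)
    (hyz : IndepFun y z P) (hzu : pdf.IsUniform z Set.univ P ν.toSphere)
    {δ : ℝ} (hδ : 0 ≤ δ) (hδ2 : δ ^ 2 ≤ 1 / 2) :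
    P {ω | δ < |inner ℝ (y ω : E) (z ω : E)|} ≤
      ENNReal.ofReal (2 * Real.exp (-(δ ^ 2 * Module.finrank ℝ E / 2))) := by
  have hm : MeasurableSet {p : Metric.sphere (0 : E) 1 × Metric.sphere (0 : E) 1 |
      δ < |inner ℝ (p.1 : E) (p.2 : E)|} :=
    (isOpen_lt continuous_const (by fun_prop)).measurableSet
  have h := (indepFun_iff_map_prod_eq_prod_map_map hy.aemeasurable hz.aemeasurable).1 hyz
  have h1 : P {ω | δ < |inner ℝ (y ω : E) (z ω : E)|} =
      P.map (fun ω => (y ω, z ω)) {p | δ < |inner ℝ (p.1 : E) (p.2 : E)|} := by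
    rw [Measure.map_apply (hy.prodMk hz) hm]
    rfl
  have := Measure.isProbabilityMeasure_map (μ := P) hy.aemeasurable
  have := Measure.isProbabilityMeasure_map (μ := P) hz.aemeasurable
  -- Fubini: freeze the first vector as the pole of the two caps; only the second one is averaged.
  rw [h1, h, Measure.prod_apply hm]
  calc _ ≤ ∫⁻ _, ENNReal.ofReal (2 * Real.exp (-(δ ^ 2 * Module.finrank ℝ E / 2))) ∂(P.map y) := by
        apply lintegral_mono
        intro a
        simp only
        rw [show P.map z = _ from hzu]
        exact cond_toSphere_abs_inner_le ν (u := (a : E)) (by simp) hδ hδ2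
    _ = _ := by simp

end SphericalCap

/-! ### Projections to spans of nearly orthonormal vectors -/

section Coherence

variable {ι E : Type*} [NormedAddCommGroup E] [InnerProductSpace ℝ E]

/-- The squared norm of a combination of almost orthogonal unit vectors. -/
theorem sum_sq_le_two_mul_norm_sq [DecidableEq ι] {s : Finset ι} {x : ι → E} {ε : ℝ}
    (hx : ∀ l ∈ s, ‖x l‖ = 1)
    (hc : ∀ l ∈ s, ∀ m ∈ s, l ≠ m → |inner ℝ (x l) (x m)| ≤ ε)
    (hε : 0 ≤ ε) (hsε : s.card * ε ≤ 1 / 2) (c : ι → ℝ) :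
    ∑ l ∈ s, c l ^ 2 ≤ 2 * ‖∑ l ∈ s, c l • x l‖ ^ 2 := by
  have h1 : ‖∑ l ∈ s, c l • x l‖ ^ 2 =
      ∑ l ∈ s, ∑ m ∈ s, c l * c m * inner ℝ (x l) (x m) := by
    rw [← real_inner_self_eq_norm_sq, sum_inner]
    refine Finset.sum_congr rfl fun l _ => ?_
    rw [inner_sum]
    refine Finset.sum_congr rfl fun m _ => ?_
    rw [inner_smul_left, inner_smul_right]
    simp [mul_assoc]
  have h2 : ∀ l ∈ s, ∀ m ∈ s, (if l = m then c l * c m else 0) - ε * (|c l| * |c m|) ≤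
      c l * c m * inner ℝ (x l) (x m) := by
    intro l hl m hm
    split_ifs with h
    · subst h
      rw [real_inner_self_eq_norm_sq, hx l hl]
      nlinarith [mul_nonneg hε (mul_nonneg (abs_nonneg (c l)) (abs_nonneg (c l)))]
    · have := neg_abs_le (c l * c m * inner ℝ (x l) (x m))
      rw [abs_mul, abs_mul] at this
      have h3 : |c l| * |c m| * |inner ℝ (x l) (x m)| ≤ |c l| * |c m| * ε := by
        gcongr
        exact hc l hl m hm h
      linarith
  -- Diagonal dominance of the Gram matrix, restoring the diagonal terms to the ε-part;
  -- Cauchy–Schwarz then turns (∑|c|)² into at most |s| ∑ c².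
  have h3 : ∑ l ∈ s, c l ^ 2 - ε * (∑ l ∈ s, |c l|) ^ 2 ≤ ‖∑ l ∈ s, c l • x l‖ ^ 2 := by
    rw [h1]
    calc _ = ∑ l ∈ s, ∑ m ∈ s, ((if l = m then c l * c m else 0) - ε * (|c l| * |c m|)) := by
          rw [sq (∑ l ∈ s, |c l|), Finset.sum_mul_sum]
          simp only [Finset.sum_sub_distrib, Finset.sum_ite_eq, Finset.mul_sum]
          congr 1
          refine Finset.sum_congr rfl fun l hl => ?_
          rw [if_pos hl, sq]
      _ ≤ _ := Finset.sum_le_sum fun l hl => Finset.sum_le_sum fun m hm => h2 l hl m hm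
  have h4 : (∑ l ∈ s, |c l|) ^ 2 ≤ s.card * ∑ l ∈ s, c l ^ 2 := by
    simpa using sq_sum_le_card_mul_sum_sq (s := s) (f := fun l => |c l|)
  have h5 : 0 ≤ ∑ l ∈ s, c l ^ 2 := Finset.sum_nonneg fun _ _ => sq_nonneg _
  nlinarith [mul_le_mul_of_nonneg_left h4 hε, mul_le_mul_of_nonneg_right hsε h5]

/-- The projection to the span of almost orthogonal unit vectors `x l` of a vector whose inner
products with the `x l` are small. -/
theorem norm_starProjection_span_sq_le [DecidableEq ι] {s : Finset ι} {x : ι → E} {ε η : ℝ}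
    (W : Submodule ℝ E) [W.HasOrthogonalProjection] (hW : W = Submodule.span ℝ (x '' s))
    (hx : ∀ l ∈ s, ‖x l‖ = 1)
    (hc : ∀ l ∈ s, ∀ m ∈ s, l ≠ m → |inner ℝ (x l) (x m)| ≤ ε)
    (hε : 0 ≤ ε) (hsε : s.card * ε ≤ 1 / 2) {a : E}
    (ha : ∀ l ∈ s, |inner ℝ a (x l)| ≤ η) :
    ‖W.starProjection a‖ ^ 2 ≤ 2 * s.card * η ^ 2 := by
  have hmem : W.starProjection a ∈ Submodule.span ℝ (x '' s) := by
    rw [← hW]; exact W.starProjection_apply_mem a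
  obtain ⟨c, hcq⟩ := Submodule.mem_span_image_finset_iff_exists_fun' ℝ |>.1 hmem
  have h1 := sum_sq_le_two_mul_norm_sq hx hc hε hsε c
  rw [hcq] at h1
  have h2 : ‖W.starProjection a‖ ^ 2 = ∑ l ∈ s, c l * inner ℝ a (x l) := by
    have h : inner ℝ (W.starProjection a) (W.starProjection a) =
        inner ℝ a (W.starProjection a) := by
      rw [W.inner_starProjection_left_eq_right,
        Submodule.starProjection_eq_self_iff.2 (W.starProjection_apply_mem a)]
    rw [← real_inner_self_eq_norm_sq, h, ← hcq, inner_sum]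
    simp [inner_smul_right]
  have h3 : ‖W.starProjection a‖ ^ 2 ≤ η * ∑ l ∈ s, |c l| := by
    rw [h2, Finset.mul_sum]
    refine Finset.sum_le_sum fun l hl => ?_
    calc _ ≤ |c l * inner ℝ a (x l)| := le_abs_self _
      _ = |c l| * |inner ℝ a (x l)| := abs_mul _ _
      _ ≤ |c l| * η := by gcongr; exact ha l hl
      _ = _ := mul_comm _ _
  have h4 : (∑ l ∈ s, |c l|) ^ 2 ≤ s.card * ∑ l ∈ s, c l ^ 2 := by
    simpa using sq_sum_le_card_mul_sum_sq (s := s) (f := fun l => |c l|)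
  set t := ‖W.starProjection a‖ ^ 2 with ht
  have ht0 : 0 ≤ t := by positivity
  -- A self-bounding inequality: t is at most η∑|c|, while ∑c² ≤ 2t. Dividing by t, when positive,
  -- finishes.
  have h5 : t ^ 2 ≤ 2 * s.card * η ^ 2 * t := by
    calc t ^ 2 ≤ (η * ∑ l ∈ s, |c l|) ^ 2 := by gcongr
      _ = η ^ 2 * (∑ l ∈ s, |c l|) ^ 2 := by ring
      _ ≤ η ^ 2 * (s.card * (2 * t)) := by
        gcongr
        exact h4.trans (by gcongr)
      _ = _ := by ring
  rcases ht0.eq_or_lt with h | h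
  · rw [← h]; positivity
  · nlinarith

theorem abs_inner_starProjection_le (W : Submodule ℝ E) [W.HasOrthogonalProjection] (a b : E)
    {s t u : ℝ} (ha : ‖W.starProjection a‖ ^ 2 ≤ s * t ^ 2)
    (hb : ‖W.starProjection b‖ ^ 2 ≤ s * u ^ 2) (hs : 0 ≤ s) (ht : 0 ≤ t) (hu : 0 ≤ u) :
    |inner ℝ a (W.starProjection b)| ≤ s * t * u := by
  have h : inner ℝ a (W.starProjection b) =
      inner ℝ (W.starProjection a) (W.starProjection b) := by
    rw [W.inner_starProjection_left_eq_right,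
      Submodule.starProjection_eq_self_iff.2 (W.starProjection_apply_mem b)]
  rw [h]
  refine (abs_real_inner_le_norm _ _).trans ?_
  refine abs_le_of_sq_le_sq' ?_ (by positivity) |>.2
  rw [mul_pow]
  calc _ ≤ (s * t ^ 2) * (s * u ^ 2) := by gcongr
    _ = _ := by ring

end Coherence

/-! ### Near-orthogonality along the causal order -/

namespace MixedGraph

/-- An acyclic graph has an injective topological rank. -/
theorem exists_topological_rank {n : ℕ} (G : MixedGraph n)
    (hG : ∀ v, ¬ Relation.TransGen G.dir v v) :
    ∃ r : Fin n → ℕ, Function.Injective r ∧ ∀ u v, G.dir u v → r u < r v := by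
  classical
  let a : Fin n → ℕ := fun v => (Finset.univ.filter fun u => Relation.TransGen G.dir u v).card
  have ha : ∀ u v, G.dir u v → a u < a v := by
    intro u v huv
    apply Finset.card_lt_card
    rw [Finset.ssubset_iff_of_subset]
    · exact ⟨u, by simpa using Relation.TransGen.single huv, by simpa using hG u⟩
    · intro w hw
      simp only [Finset.mem_filter, Finset.mem_univ, true_and] at hw ⊢
      exact hw.tail huv
  -- The number of ancestors `a` increases along edges; adding `v < n` breaks ties without
  -- disturbing this order.
  refine ⟨fun v => n * a v + v, ?_, ?_⟩
  · intro u v h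
    have h' : n * a u + u = n * a v + v := h
    have := congrArg (· % n) h'
    simp only [Nat.mul_add_mod, Nat.mod_eq_of_lt u.2, Nat.mod_eq_of_lt v.2] at this
    exact Fin.ext this
  · intro u v h
    have h1 := ha u v h
    have h2 : n * (a u + 1) ≤ n * a v := Nat.mul_le_mul_left _ h1
    have := u.2
    simp only
    nlinarith

theorem mem_pa {n : ℕ} {G : MixedGraph n} {u v : Fin n} : u ∈ G.pa v ↔ G.dir u v := by
  simp [pa]

/-- Vectors generated along an acyclic graph, from almost orthogonal unit vectors, by removing the
components in the span of the vectors of the parents and normalizing, are almost orthogonal unit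
vectors. -/
theorem coherence_of_generated {n k : ℕ} (hk : 1 ≤ k) {G : MixedGraph n} (hG : G.IsBowFree k)
    {E : Type*} [NormedAddCommGroup E] [InnerProductSpace ℝ E] [FiniteDimensional ℝ E]
    {x y : Fin n → E} {δ : ℝ} (hδ : 0 ≤ δ) (hδk : 32 * k * δ ≤ 1)
    (hy : ∀ i, ‖y i‖ = 1) (hyy : ∀ i j, i ≠ j → |inner ℝ (y i) (y j)| ≤ δ)
    (hxy : ∀ i, x i = ‖(Submodule.span ℝ {z | ∃ j ∈ G.pa i, z = x j})ᗮ.starProjection (y i)‖⁻¹ •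
      (Submodule.span ℝ {z | ∃ j ∈ G.pa i, z = x j})ᗮ.starProjection (y i)) :
    (∀ i, ‖x i‖ = 1) ∧ ∀ i j, i ≠ j → |inner ℝ (x i) (x j)| ≤ 4 * δ := by
  obtain ⟨r, hr, hrG⟩ := G.exists_topological_rank hG.acyclic
  have hk' : (1 : ℝ) ≤ k := by exact_mod_cast hk
  -- The induction must also control the not yet processed `y i` against `x j`: this is what bounds
  -- the projections at later vertices.
  have key : ∀ m : ℕ, ∀ j, r j = m → ‖x j‖ = 1 ∧ (∀ i, r j < r i → |inner ℝ (y i) (x j)| ≤ 2 * δ) ∧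
      ∀ i, r i < r j → |inner ℝ (x i) (x j)| ≤ 4 * δ := by
    intro m
    induction m using Nat.strong_induction_on with
    | _ m ih =>
    rintro j rfl
    have ih' : ∀ l, r l < r j → ‖x l‖ = 1 ∧ (∀ i, r l < r i → |inner ℝ (y i) (x l)| ≤ 2 * δ) ∧
      ∀ i, r i < r l → |inner ℝ (x i) (x l)| ≤ 4 * δ := fun l hl => ih _ hl l rfl
    have hpa : ∀ l ∈ G.pa j, r l < r j := fun l hl => hrG _ _ (mem_pa.1 hl)
    have hcoh : ∀ i l, r i < r j → r l < r j → i ≠ l → |inner ℝ (x i) (x l)| ≤ 4 * δ := by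
      intro i l hi hl hil
      rcases lt_or_gt_of_ne (hr.ne hil) with h | h
      · exact (ih' l hl).2.2 i h
      · rw [real_inner_comm]
        exact (ih' i hi).2.2 l h
    have hcard : ((G.pa j).card : ℝ) ≤ k := by exact_mod_cast hG.indegree_le j
    set W := Submodule.span ℝ {z | ∃ j' ∈ G.pa j, z = x j'} with hWdef
    have hW : W = Submodule.span ℝ (x '' (G.pa j : Set (Fin n))) := by
      rw [hWdef]
      congr 1
      ext z
      simp [eq_comm]
    have hproj : ∀ a : E, ∀ η : ℝ, (∀ l ∈ G.pa j, |inner ℝ a (x l)| ≤ η) →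
        ‖W.starProjection a‖ ^ 2 ≤ 2 * k * η ^ 2 := by
      intro a η ha
      refine (norm_starProjection_span_sq_le W hW (fun l hl => (ih' l (hpa l hl)).1)
        (fun l hl l' hl' h => hcoh l l' (hpa l hl) (hpa l' hl') h) (by positivity) ?_ ha).trans ?_
      · have : ((G.pa j).card : ℝ) * (4 * δ) ≤ k * (4 * δ) := by gcongr
        linarith
      · gcongr
    have hyj := hproj (y j) (2 * δ)
      fun l hl => (ih' l (hpa l hl)).2.1 j (hpa l hl)
    set p := Wᗮ.starProjection (y j) with hp
    have hpq : p = y j - W.starProjection (y j) := by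
      rw [hp, Submodule.starProjection_orthogonal_val]
    have hxj : x j = ‖p‖⁻¹ • p := hxy j
    have hnorm : 1 = ‖W.starProjection (y j)‖ ^ 2 + ‖p‖ ^ 2 := by
      rw [hp, ← W.norm_sq_eq_add_norm_sq_starProjection, hy, one_pow]
    have hδ1 : k * δ ^ 2 * 32 ≤ δ := by nlinarith
    have hδ2 : δ ≤ 1 / 32 := by nlinarith
    -- The removed part has squared norm at most 2k(2δ)² = 8kδ² ≤ δ/4, so normalizing costs at most
    -- a factor 1/0.9.
    have hp9 : 0.9 ≤ ‖p‖ := by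
      refine le_of_sq_le_sq ?_ (norm_nonneg _)
      nlinarith
    have hinner : ∀ a : E, ∀ t : ℝ, |inner ℝ a p| ≤ 0.9 * t → |inner ℝ a (x j)| ≤ t := by
      intro a t h
      rw [hxj, inner_smul_right, abs_mul, abs_inv, abs_norm, inv_mul_le_iff₀ (by linarith)]
      have : 0 ≤ t := by linarith [abs_nonneg (inner ℝ a p)]
      nlinarith
    have hdiff : ∀ a : E, |inner ℝ a p| ≤ |inner ℝ a (y j)| + |inner ℝ a (W.starProjection (y j))| := by
      intro a
      rw [hpq, inner_sub_right]
      exact abs_sub _ _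
    refine ⟨?_, ?_, ?_⟩
    · rw [hxj, norm_smul, norm_inv, norm_norm, inv_mul_cancel₀ (by linarith)]
    · intro i hi
      refine hinner _ _ ((hdiff _).trans ?_)
      have h1 := hyy i j (fun h => by subst h; exact lt_irrefl _ hi)
      have h2 := abs_inner_starProjection_le W (y i) (y j)
        (hproj (y i) (2 * δ)
          fun l hl => (ih' l (hpa l hl)).2.1 i ((hpa l hl).trans hi)) hyj
        (by positivity) (by positivity) (by positivity)
      nlinarith
    · intro i hi
      -- A parent's vector lies in the span, so its projection is not small; but there orthogonality
      -- is exact.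
      by_cases hij : i ∈ G.pa j
      · have h0 : inner ℝ (x i) p = 0 := by
          have hmem : p ∈ Wᗮ := Wᗮ.starProjection_apply_mem (y j)
          exact hmem (x i) (Submodule.subset_span ⟨i, hij, rfl⟩)
        exact hinner _ _ (by rw [h0]; simp; positivity)
      · refine hinner _ _ ((hdiff _).trans ?_)
        have h1 := (ih' i hi).2.1 j hi
        rw [real_inner_comm] at h1
        have h2 := abs_inner_starProjection_le W (x i) (y j)
          (hproj (x i) (4 * δ) fun l hl =>
            hcoh i l hi (hpa l hl) (fun h => hij (h ▸ hl))) hyj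
          (by positivity) (by positivity) (by positivity)
        nlinarith
  refine ⟨fun i => (key _ i rfl).1, fun i j hij => ?_⟩
  rcases lt_or_gt_of_ne (hr.ne hij) with h | h
  · exact (key _ j rfl).2.2 i h
  · rw [real_inner_comm]
    exact (key _ i rfl).2.2 j h

end MixedGraph

/-! ### Spectral norms and absolute row and column sums -/

section MatrixNorms

/-- The spectral norm is bounded by the Frobenius norm. -/
theorem Matrix.l2_opNorm_le_of_sum_sq_le {m n : Type*} [Fintype m] [Fintype n] [DecidableEq n]
    (A : Matrix m n ℝ) {f : ℝ} (hf : 0 ≤ f) (h : ∑ i, ∑ j, A i j ^ 2 ≤ f ^ 2) : ‖A‖ ≤ f := by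
  rw [Matrix.l2_opNorm_def]
  refine ContinuousLinearMap.opNorm_le_bound _ hf fun x => ?_
  refine le_of_sq_le_sq ?_ (by positivity)
  rw [mul_pow, EuclideanSpace.real_norm_sq_eq, EuclideanSpace.real_norm_sq_eq]
  calc _ = ∑ i, (∑ j, A i j * x j) ^ 2 := rfl
    _ ≤ ∑ i, (∑ j, A i j ^ 2) * ∑ j, x j ^ 2 :=
      Finset.sum_le_sum fun i _ => Finset.sum_mul_sq_le_sq_mul_sq _ _ _
    _ = (∑ i, ∑ j, A i j ^ 2) * ∑ j, x j ^ 2 := by rw [Finset.sum_mul]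
    _ ≤ _ := by gcongr

/-- The identity M⁻¹ = 1 - (M - 1)M⁻¹ bounds ‖M⁻¹‖ by 1 + e‖M⁻¹‖. An empty index type, arising from
vertices without parents, is allowed; there the identity has norm 0. -/
theorem isUnit_det_and_spectralCond_le {ι : Type*} [Fintype ι] [DecidableEq ι] {M : Matrix ι ι ℝ}
    {e : ℝ} (he : e < 1) (hM : ‖M - 1‖ ≤ e) :
    IsUnit M.det ∧ spectralCond M ≤ (1 + e) / (1 - e) := by
  have hu : IsUnit M := by
    have h : ‖1 - M‖ < 1 := by rw [norm_sub_rev]; linarith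
    have := isUnit_one_sub_of_norm_lt_one h
    rwa [sub_sub_cancel] at this
  have hdet := (Matrix.isUnit_iff_isUnit_det M).1 hu
  have h1 : ‖(1 : Matrix ι ι ℝ)‖ ≤ 1 := by
    rcases isEmpty_or_nonempty ι with hι | hι
    · rw [Subsingleton.elim (1 : Matrix ι ι ℝ) 0, norm_zero]
      exact zero_le_one
    · exact CStarRing.norm_one.le
  have hMn : ‖M‖ ≤ 1 + e := by
    calc ‖M‖ = ‖1 + (M - 1)‖ := by rw [add_sub_cancel]
      _ ≤ _ := (norm_add_le _ _).trans (add_le_add h1 hM)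
  have hinv : ‖M⁻¹‖ ≤ 1 / (1 - e) := by
    have h2 : M⁻¹ = 1 - (M - 1) * M⁻¹ := by
      rw [sub_mul, Matrix.mul_nonsing_inv _ hdet]
      simp
    have h3 : ‖M⁻¹‖ ≤ 1 + e * ‖M⁻¹‖ := by
      calc ‖M⁻¹‖ = ‖1 - (M - 1) * M⁻¹‖ := by rw [← h2]
        _ ≤ ‖(1 : Matrix ι ι ℝ)‖ + ‖(M - 1) * M⁻¹‖ := norm_sub_le _ _
        _ ≤ 1 + ‖M - 1‖ * ‖M⁻¹‖ := add_le_add h1 (norm_mul_le _ _)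
        _ ≤ _ := by gcongr
    rw [le_div_iff₀ (by linarith)]
    linarith
  refine ⟨hdet, ?_⟩
  have he0 : 0 ≤ e := (norm_nonneg _).trans hM
  calc spectralCond M ≤ 1 / (1 - e) * (1 + e) := by
        unfold spectralCond
        gcongr
    _ = _ := by ring

/-- All absolute row sums and column sums are at most `s`. -/
structure Matrix.AbsSumsLE {ι : Type*} [Fintype ι] (A : Matrix ι ι ℝ) (s : ℝ) : Prop where
  col : ∀ b, ∑ a, |A a b| ≤ s
  row : ∀ a, ∑ b, |A a b| ≤ s

namespace Matrix.AbsSumsLE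

variable {ι : Type*} [Fintype ι] {A B : Matrix ι ι ℝ} {s t : ℝ}

theorem transpose (hA : A.AbsSumsLE s) : Aᵀ.AbsSumsLE s := ⟨hA.row, hA.col⟩

theorem add (hA : A.AbsSumsLE s) (hB : B.AbsSumsLE t) : (A + B).AbsSumsLE (s + t) where
  col b := by
    calc _ ≤ ∑ a, (|A a b| + |B a b|) := Finset.sum_le_sum fun a _ => abs_add_le _ _
      _ ≤ _ := by rw [Finset.sum_add_distrib]; exact add_le_add (hA.col b) (hB.col b)
  row a := by
    calc _ ≤ ∑ b, (|A a b| + |B a b|) := Finset.sum_le_sum fun b _ => abs_add_le _ _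
      _ ≤ _ := by rw [Finset.sum_add_distrib]; exact add_le_add (hA.row a) (hB.row a)

theorem sum_abs_mul_le (hA : ∀ b, ∑ a, |A a b| ≤ s) (B : Matrix ι ι ℝ) (b : ι) :
    ∑ a, |(A * B) a b| ≤ s * ∑ c, |B c b| := by
  calc _ ≤ ∑ a, ∑ c, |A a c| * |B c b| := by
        refine Finset.sum_le_sum fun a _ => ?_
        rw [Matrix.mul_apply]
        refine (Finset.abs_sum_le_sum_abs _ _).trans (le_of_eq ?_)
        simp only [abs_mul]
    _ = ∑ c, (∑ a, |A a c|) * |B c b| := by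
        rw [Finset.sum_comm]
        simp only [Finset.sum_mul]
    _ ≤ ∑ c, s * |B c b| := by
        gcongr with c
        exact hA c
    _ = _ := by rw [Finset.mul_sum]

theorem sum_abs_mul_le' (hB : ∀ a, ∑ b, |B a b| ≤ s) (A : Matrix ι ι ℝ) (a : ι) :
    ∑ b, |(A * B) a b| ≤ s * ∑ c, |A a c| := by
  have := sum_abs_mul_le (A := Bᵀ) hB Aᵀ a
  rw [← Matrix.transpose_mul] at this
  exact this

theorem mul (hA : A.AbsSumsLE s) (hB : B.AbsSumsLE t) (hs : 0 ≤ s) (ht : 0 ≤ t) :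
    (A * B).AbsSumsLE (s * t) where
  col b := (sum_abs_mul_le hA.col B b).trans (by gcongr; exact hB.col b)
  row a := (sum_abs_mul_le' hB.row A a).trans (by rw [mul_comm]; gcongr; exact hA.row a)

theorem sum_sq_le (hA : A.AbsSumsLE s) (b : ι) : ∑ a, A a b ^ 2 ≤ s ^ 2 := by
  have h0 : 0 ≤ ∑ a, |A a b| := Finset.sum_nonneg fun _ _ => abs_nonneg _
  calc _ = ∑ a, |A a b| ^ 2 := by simp
    _ ≤ ∑ a, |A a b| * ∑ a, |A a b| := by
        refine Finset.sum_le_sum fun a _ => ?_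
        rw [sq]
        gcongr
        exact Finset.single_le_sum (f := fun a => |A a b|) (fun _ _ => abs_nonneg _)
          (Finset.mem_univ a)
    _ = (∑ a, |A a b|) ^ 2 := by rw [← Finset.sum_mul, sq]
    _ ≤ _ := by gcongr; exact hA.col b

theorem abs_conj_apply_le (hA : A.AbsSumsLE s) (hZ : ∀ i j, |B i j| ≤ t) (ht : 0 ≤ t)
    (a b : ι) : |(Aᵀ * B * A) a b| ≤ s ^ 2 * t := by
  have hs : 0 ≤ s := (Finset.sum_nonneg fun _ _ => abs_nonneg _).trans (hA.col a)
  have h1 : ∀ j, |(Aᵀ * B) a j| ≤ s * t := by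
    intro j
    rw [Matrix.mul_apply]
    calc _ ≤ ∑ i, |A i a| * |B i j| := by
          refine (Finset.abs_sum_le_sum_abs _ _).trans (le_of_eq ?_)
          simp only [abs_mul, Matrix.transpose_apply]
      _ ≤ ∑ i, |A i a| * t := by gcongr with i; exact hZ i j
      _ ≤ _ := by rw [← Finset.sum_mul]; gcongr; exact hA.col a
  rw [Matrix.mul_apply]
  calc _ ≤ ∑ j, |(Aᵀ * B) a j| * |A j b| := by
        refine (Finset.abs_sum_le_sum_abs _ _).trans (le_of_eq ?_)
        simp only [abs_mul]
    _ ≤ ∑ j, s * t * |A j b| := by gcongr with j; exact h1 j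
    _ ≤ s * t * s := by rw [← Finset.mul_sum]; gcongr; exact hA.col b
    _ = _ := by ring

variable [DecidableEq ι]

/-- The matrix 1 - A is strictly diagonally dominant by rows. -/
theorem isUnit_one_sub (hA : A.AbsSumsLE s) (hs : s < 1) : IsUnit (1 - A).det := by
  rw [isUnit_iff_ne_zero]
  refine det_ne_zero_of_sum_row_lt_diag fun a => ?_
  have h1 : ∑ b ∈ Finset.univ.erase a, ‖(1 - A) a b‖ = ∑ b ∈ Finset.univ.erase a, |A a b| := by
    refine Finset.sum_congr rfl fun b hb => ?_
    rw [Matrix.sub_apply, Matrix.one_apply_ne (Finset.ne_of_mem_erase hb).symm, zero_sub, norm_neg,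
      Real.norm_eq_abs]
  have h2 := Finset.add_sum_erase Finset.univ (fun b => |A a b|) (Finset.mem_univ a)
  beta_reduce at h2
  have h3 : 1 - |A a a| ≤ ‖(1 - A) a a‖ := by
    rw [Matrix.sub_apply, Matrix.one_apply_eq, Real.norm_eq_abs]
    have := abs_sub_abs_le_abs_sub 1 (A a a)
    rwa [abs_one] at this
  rw [h1]
  have := hA.row a
  linarith

/-- No series is needed: T = 1 + AT and T = 1 + TA make each column or row sum σ of |T| satisfy σ ≤
1 + sσ. -/
theorem one_sub_inv (hA : A.AbsSumsLE s) (hs : s < 1) : (1 - A)⁻¹.AbsSumsLE (1 / (1 - s)) := by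
  have hu := hA.isUnit_one_sub hs
  set T := (1 - A)⁻¹
  have h1 : T = 1 + A * T := by
    have : (1 - A) * T = 1 := Matrix.mul_nonsing_inv _ hu
    rw [sub_mul, one_mul] at this
    rw [← this, sub_add_cancel]
  have h2 : T = 1 + T * A := by
    have : T * (1 - A) = 1 := Matrix.nonsing_inv_mul _ hu
    rw [mul_sub, mul_one] at this
    rw [← this, sub_add_cancel]
  constructor
  · intro b
    have h : ∑ a, |T a b| ≤ 1 + s * ∑ a, |T a b| := by
      calc ∑ a, |T a b| = ∑ a, |(1 + A * T) a b| := by rw [← h1]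
        _ ≤ ∑ a, (|(1 : Matrix ι ι ℝ) a b| + |(A * T) a b|) :=
          Finset.sum_le_sum fun a _ => abs_add_le _ _
        _ = 1 + ∑ a, |(A * T) a b| := by
          rw [Finset.sum_add_distrib]
          simp [Matrix.one_apply, apply_ite abs]
        _ ≤ _ := by gcongr; exact sum_abs_mul_le hA.col T b
    rw [le_div_iff₀ (by linarith)]
    linarith
  · intro a
    have h : ∑ b, |T a b| ≤ 1 + s * ∑ b, |T a b| := by
      calc ∑ b, |T a b| = ∑ b, |(1 + T * A) a b| := by rw [← h2]
        _ ≤ ∑ b, (|(1 : Matrix ι ι ℝ) a b| + |(T * A) a b|) :=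
          Finset.sum_le_sum fun b _ => abs_add_le _ _
        _ = 1 + ∑ b, |(T * A) a b| := by
          rw [Finset.sum_add_distrib]
          simp [Matrix.one_apply, apply_ite abs]
        _ ≤ _ := by gcongr; exact sum_abs_mul_le' hA.row T a
    rw [le_div_iff₀ (by linarith)]
    linarith

end Matrix.AbsSumsLE

end MatrixNorms

/-! ### Frobenius bounds for blocks -/

section Blocks

variable {n : ℕ}

theorem blk_add (M N : Matrix (Fin n) (Fin n) ℝ) (I J : Finset (Fin n)) :
    blk (M + N) I J = blk M I J + blk N I J := rfl

theorem norm_blk_le_of_sum_col_sq_le {M : Matrix (Fin n) (Fin n) ℝ} {A B : Finset (Fin n)}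
    {g f : ℝ} (hf : 0 ≤ f) (hM : ∀ b, ∑ a, M a b ^ 2 ≤ g) (h : B.card * g ≤ f ^ 2) :
    ‖blk M A B‖ ≤ f := by
  refine Matrix.l2_opNorm_le_of_sum_sq_le _ hf (le_trans ?_ h)
  rw [Finset.sum_comm]
  calc _ ≤ ∑ _b : B, g := by
        refine Finset.sum_le_sum fun b _ => le_trans ?_ (hM b)
        calc _ = ∑ a ∈ A, M a b ^ 2 := Finset.sum_coe_sort A fun a => M a b ^ 2
          _ ≤ _ := Finset.sum_le_sum_of_subset_of_nonneg (Finset.subset_univ _)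
            fun _ _ _ => sq_nonneg _
    _ = _ := by simp

theorem norm_blk_le_of_abs_le {M : Matrix (Fin n) (Fin n) ℝ} {A B : Finset (Fin n)}
    {t f : ℝ} (hf : 0 ≤ f) (hM : ∀ a b, |M a b| ≤ t) (h : A.card * (B.card * t ^ 2) ≤ f ^ 2) :
    ‖blk M A B‖ ≤ f := by
  refine Matrix.l2_opNorm_le_of_sum_sq_le _ hf (le_trans ?_ h)
  calc _ ≤ ∑ _a : A, ∑ _b : B, t ^ 2 := by
        refine Finset.sum_le_sum fun a _ => Finset.sum_le_sum fun b _ => ?_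
        exact sq_le_sq' (neg_le_of_abs_le (hM a b)) (le_of_abs_le (hM a b))
    _ = _ := by simp

end Blocks

/-! ### The covariance matrix as a perturbation of the identity -/

namespace MixedGraph

variable {n k : ℕ} {G : MixedGraph n} {L : Matrix (Fin n) (Fin n) ℝ} {h : ℝ}

/-- Applied with φ the absolute value and the square; `φ 0 = 0` leaves only the at most k parents in
the sum. -/
theorem sum_col_comp_le (hG : G.IsBowFree k) (hL0 : ∀ u v, ¬ G.dir u v → L u v = 0)
    (φ : ℝ → ℝ) (hφ0 : φ 0 = 0) {t : ℝ} (ht : 0 ≤ t) (hφ : ∀ u v, φ (L u v) ≤ t) (v : Fin n) :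
    ∑ u, φ (L u v) ≤ k * t := by
  classical
  have h1 : ∑ u, φ (L u v) = ∑ u ∈ G.pa v, φ (L u v) := by
    refine (Finset.sum_subset (Finset.subset_univ _) fun u _ hu => ?_).symm
    rw [hL0 u v (by simpa [pa] using hu), hφ0]
  rw [h1]
  calc _ ≤ ∑ _u ∈ G.pa v, t := Finset.sum_le_sum fun u _ => hφ u v
    _ = (G.pa v).card * t := by simp
    _ ≤ _ := by gcongr; exact hG.indegree_le v

theorem sum_row_comp_le (hG : G.IsBowFree k) (hL0 : ∀ u v, ¬ G.dir u v → L u v = 0)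
    (φ : ℝ → ℝ) (hφ0 : φ 0 = 0) {t : ℝ} (ht : 0 ≤ t) (hφ : ∀ u v, φ (L u v) ≤ t) (u : Fin n) :
    ∑ v, φ (L u v) ≤ k * t := by
  classical
  have h1 : ∑ v, φ (L u v) = ∑ v ∈ G.ch u, φ (L u v) := by
    refine (Finset.sum_subset (Finset.subset_univ _) fun v _ hv => ?_).symm
    rw [hL0 u v (by simpa [ch] using hv), hφ0]
  rw [h1]
  calc _ ≤ ∑ _v ∈ G.ch u, t := Finset.sum_le_sum fun v _ => hφ u v
    _ = (G.ch u).card * t := by simp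
    _ ≤ _ := by gcongr; exact hG.outdegree_le u

theorem absSumsLE_of_edge_le (hk : 1 ≤ k) (hG : G.IsBowFree k) (hh : 0 ≤ h)
    (hL0 : ∀ u v, ¬ G.dir u v → L u v = 0) (hL : ∀ u v, |L u v| ≤ h / k) : L.AbsSumsLE h := by
  have hk' : (0 : ℝ) < k := by exact_mod_cast hk
  have he : k * (h / k) = h := by field_simp
  constructor
  · intro v
    have := sum_col_comp_le hG hL0 (fun t => |t|) abs_zero (by positivity) hL v
    rwa [he] at this
  · intro u
    have := sum_row_comp_le hG hL0 (fun t => |t|) abs_zero (by positivity) hL u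
    rwa [he] at this

theorem norm_blk_weights_le (hk : 1 ≤ k) (hG : G.IsBowFree k) (hh : 0 ≤ h)
    (hL0 : ∀ u v, ¬ G.dir u v → L u v = 0) (hL : ∀ u v, |L u v| ≤ h / k)
    (A : Finset (Fin n)) {B : Finset (Fin n)} (hB : B.card ≤ k) : ‖blk L A B‖ ≤ h := by
  have hk' : (0 : ℝ) < k := by exact_mod_cast hk
  refine norm_blk_le_of_sum_col_sq_le hh (g := k * (h / k) ^ 2) ?_ ?_
  · exact sum_col_comp_le hG hL0 (fun t => t ^ 2) (by simp) (by positivity)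
      fun u v => sq_le_sq' (neg_le_of_abs_le (hL u v)) (le_of_abs_le (hL u v))
  · calc _ ≤ (k : ℝ) * (k * (h / k) ^ 2) := by gcongr
      _ = _ := by field_simp

/-- By acyclicity `L u v` and `L v u` are never both nonzero, so the squares add and the factor is
√2 < 1.42. The factor 2 of the triangle inequality would leave no room for the other terms when α =
2h. -/
theorem norm_blk_weights_add_transpose_le (hk : 1 ≤ k) (hG : G.IsBowFree k) (hh : 0 ≤ h)
    (hL0 : ∀ u v, ¬ G.dir u v → L u v = 0) (hL : ∀ u v, |L u v| ≤ h / k)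
    (A : Finset (Fin n)) {B : Finset (Fin n)} (hB : B.card ≤ k) :
    ‖blk (L + Lᵀ) A B‖ ≤ 1.42 * h := by
  have hk' : (0 : ℝ) < k := by exact_mod_cast hk
  have hsq : ∀ u v, L u v ^ 2 ≤ (h / k) ^ 2 :=
    fun u v => sq_le_sq' (neg_le_of_abs_le (hL u v)) (le_of_abs_le (hL u v))
  refine norm_blk_le_of_sum_col_sq_le (by positivity) (g := 2 * (k * (h / k) ^ 2)) ?_ ?_
  · intro v
    have h1 : ∀ u, (L + Lᵀ) u v ^ 2 = L u v ^ 2 + L v u ^ 2 := by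
      intro u
      rw [Matrix.add_apply, Matrix.transpose_apply]
      by_cases huv : G.dir u v
      · rw [hL0 v u fun hvu => hG.acyclic v ((Relation.TransGen.single hvu).tail huv)]
        ring
      · rw [hL0 u v huv]
        ring
    simp only [h1, Finset.sum_add_distrib]
    have h2 := sum_col_comp_le hG hL0 (fun t => t ^ 2) (by simp) (by positivity) hsq v
    have h3 := sum_row_comp_le hG hL0 (fun t => t ^ 2) (by simp) (by positivity) hsq v
    beta_reduce at h2 h3
    linarith
  · calc _ ≤ (k : ℝ) * (2 * (k * (h / k) ^ 2)) := by gcongr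
      _ = 2 * h ^ 2 := by field_simp
      _ ≤ _ := by nlinarith [sq_nonneg h]

/-- The covariance matrix of a model with small weights and almost orthogonal noise is close to the
identity on small blocks. -/
theorem norm_blk_lsemCov_sub_one_le (hk : 1 ≤ k) (hG : G.IsBowFree k) (hh : 0 ≤ h)
    (hhk : 20 * (k + 1) * h ≤ 1)
    (hL0 : ∀ u v, ¬ G.dir u v → L u v = 0) (hL : ∀ u v, |L u v| ≤ h / k)
    {W : Matrix (Fin n) (Fin n) ℝ} (hW : ∀ i j, |(W - 1) i j| ≤ h / (10 * k ^ 2))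
    {A B : Finset (Fin n)} (hA : A.card ≤ k ^ 2) (hB : B.card ≤ k) :
    ‖blk (lsemCov L W - 1) A B‖ ≤ 1.7 * h := by
  have hk1 : (1 : ℝ) ≤ k := by exact_mod_cast hk
  have hB' : (B.card : ℝ) ≤ k := by exact_mod_cast hB
  have hA' : (A.card : ℝ) ≤ k ^ 2 := by exact_mod_cast hA
  have hh40 : 40 * h ≤ 1 := by nlinarith
  have hLs := absSumsLE_of_edge_le hk hG hh hL0 hL
  have hu := hLs.isUnit_one_sub (by linarith)
  have hTs := hLs.one_sub_inv (by linarith)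
  set s := 1 / (1 - h) with hs
  have hs0 : 0 ≤ s := one_div_nonneg.2 (by linarith)
  have hs1 : s ≤ 1.026 := by
    rw [hs, div_le_iff₀ (by linarith)]
    linarith
  set T := (1 - L)⁻¹ with hT
  have hTL : T = 1 + L * T := by
    have : (1 - L) * T = 1 := Matrix.mul_nonsing_inv _ hu
    rw [sub_mul, one_mul] at this
    rw [← this, sub_add_cancel]
  have hNs : (L * T).AbsSumsLE (h * s) := hLs.mul hTs hh hs0
  -- N = T - 1 is the sum over nonempty directed paths; L is its first-order part.
  set N := L * T with hN
  have hNL : N = L + L * N := by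
    rw [hN]
    conv_lhs => rw [hTL]
    rw [mul_add, mul_one]
  have hLN := hLs.mul hNs hh (by positivity)
  have hR := (hLN.add hLN.transpose).add (hNs.transpose.mul hNs (by positivity) (by positivity))
  set R := L * N + (L * N)ᵀ + Nᵀ * N with hRdef
  have hdec : lsemCov L W - 1 = (L + Lᵀ) + R + Tᵀ * (W - 1) * T := by
    have h1 : Tᵀ * T = 1 + N + Nᵀ + Nᵀ * N := by
      rw [hTL, Matrix.transpose_add, Matrix.transpose_one]
      noncomm_ring
    have h2 : N + Nᵀ = L + Lᵀ + (L * N + (L * N)ᵀ) := by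
      conv_lhs => rw [hNL]
      rw [Matrix.transpose_add]
      abel
    have h3 : lsemCov L W = Tᵀ * T + Tᵀ * (W - 1) * T := by
      rw [lsemCov, mul_sub, sub_mul, mul_one]
      abel
    rw [h3, h1, add_assoc 1, h2, hRdef]
    abel
  rw [hdec, blk_add, blk_add]
  have hb1 := norm_blk_weights_add_transpose_le hk hG hh hL0 hL A hB
  have hb2 : ‖blk R A B‖ ≤ 0.08 * h := by
    refine norm_blk_le_of_sum_col_sq_le (by positivity) hR.sum_sq_le ?_
    have h1 : h * (h * s) + h * (h * s) + h * s * (h * s) ≤ 3.2 * h ^ 2 := by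
      have : s ^ 2 ≤ 1.026 ^ 2 := by gcongr
      nlinarith [sq_nonneg h]
    have h0 : 0 ≤ h * (h * s) + h * (h * s) + h * s * (h * s) := by positivity
    -- From (k + 1)² ≥ 4k. This pays for the factor √k lost in passing from column sums of R, of
    -- order h², to the block norm.
    have h2 : (k : ℝ) * h ^ 2 ≤ 1 / 1600 := by
      have h3 : (20 * (k + 1) * h) ^ 2 ≤ 1 ^ 2 := by gcongr
      nlinarith [mul_nonneg (sq_nonneg ((k : ℝ) - 1)) (sq_nonneg h)]
    calc _ ≤ (k : ℝ) * (3.2 * h ^ 2) ^ 2 := by gcongr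
      _ = 3.2 ^ 2 * (k * h ^ 2) * h ^ 2 := by ring
      _ ≤ 3.2 ^ 2 * (1 / 1600) * h ^ 2 := by gcongr
      _ = _ := by ring
  have hb3 : ‖blk (Tᵀ * (W - 1) * T) A B‖ ≤ 0.2 * h := by
    refine norm_blk_le_of_abs_le (by positivity)
      (fun a b => hTs.abs_conj_apply_le hW (by positivity) a b) ?_
    have h1 : s ^ 2 * (h / (10 * k ^ 2)) ≤ 2 * (h / (10 * k ^ 2)) := by
      have : s ^ 2 ≤ 2 := by nlinarith
      gcongr
    calc _ ≤ (k : ℝ) ^ 2 * (k * (2 * (h / (10 * k ^ 2))) ^ 2) :=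
          mul_le_mul hA' (mul_le_mul hB' (pow_le_pow_left₀ (by positivity) h1 2) (sq_nonneg _)
            (by positivity)) (mul_nonneg (Nat.cast_nonneg _) (sq_nonneg _)) (by positivity)
      _ = (0.2 * h) ^ 2 / k := by field_simp; ring
      _ ≤ _ := div_le_self (by positivity) hk1
  calc _ ≤ ‖blk (L + Lᵀ) A B‖ + ‖blk R A B‖ + ‖blk (Tᵀ * (W - 1) * T) A B‖ := norm_add₃_le
    _ ≤ _ := by linarith

end MixedGraph

/-! ### The structural assumptions on the good event -/

namespace MixedGraph

variable {n k : ℕ} {G : MixedGraph n}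

theorem self_notMem_pa (hG : G.IsBowFree k) (v : Fin n) : v ∉ G.pa v :=
  fun h => hG.acyclic v (Relation.TransGen.single (mem_pa.1 h))

theorem self_notMem_spa (hG : G.IsBowFree k) (v : Fin n) : v ∉ G.spa v := by
  intro h
  obtain ⟨u, hu, hv⟩ := Finset.mem_biUnion.1 h
  exact hG.acyclic v ((Relation.TransGen.single (mem_pa.1 hv)).tail (mem_pa.1 hu))

theorem card_spa_le (hG : G.IsBowFree k) (v : Fin n) : (G.spa v).card ≤ k ^ 2 := by
  calc _ ≤ (G.pa v).card * k := Finset.card_biUnion_le_card_mul _ _ _ fun u _ => hG.indegree_le u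
    _ ≤ k * k := Nat.mul_le_mul_right _ (hG.indegree_le v)
    _ = _ := (sq k).symm

theorem spa_eq_empty_of_pa {v : Fin n} (h : G.pa v = ∅) : G.spa v = ∅ := by
  rw [spa, h, Finset.biUnion_empty]

theorem blk_sub_one_of_disjoint (M : Matrix (Fin n) (Fin n) ℝ) {A B : Finset (Fin n)}
    (h : Disjoint A B) : blk (M - 1) A B = blk M A B := by
  ext a b
  have hab : (a : Fin n) ≠ b := fun h' => Finset.disjoint_left.1 h a.2 (h' ▸ b.2)
  simp [blk, Matrix.one_apply_ne hab]

theorem blk_sub_one_self (M : Matrix (Fin n) (Fin n) ℝ) (B : Finset (Fin n)) :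
    blk (M - 1) B B = blk M B B - 1 := by
  rw [blk, blk, Matrix.submatrix_sub, Pi.sub_apply, Pi.sub_apply,
    Matrix.submatrix_one _ Subtype.val_injective]

theorem norm_blk_of_isEmpty_left (M : Matrix (Fin n) (Fin n) ℝ) (B : Finset (Fin n)) :
    ‖blk M ∅ B‖ = 0 := by
  rw [Subsingleton.elim (blk M ∅ B) 0, norm_zero]

/-- If all small blocks of `Sg - 1` are small, then `Sg` satisfies the assumptions on the input
condition number and on the diagonal dominance. -/
theorem assumptions_of_norm_blk_sub_one_le (hk : 1 ≤ k) (hG : G.IsBowFree k)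
    {Sg : Matrix (Fin n) (Fin n) ℝ} {e α : ℝ} (he1 : e < 1) (hα : 0 ≤ α)
    (heα : e ≤ α * (1 - e))
    (hS : ∀ A B : Finset (Fin n), A.card ≤ k ^ 2 → B.card ≤ k → ‖blk (Sg - 1) A B‖ ≤ e) :
    AssumptionA1 G Sg ((1 + e) / (1 - e)) ∧ AssumptionA2 G Sg α := by
  have hcard : ∀ v, (G.pa v).card ≤ k ^ 2 := fun v =>
    (hG.indegree_le v).trans (Nat.le_self_pow two_ne_zero k)
  have hE : ∀ v, ‖blk Sg (G.pa v) (G.pa v) - 1‖ ≤ e := fun v => by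
    rw [← blk_sub_one_self]
    exact hS _ _ (hcard v) (hG.indegree_le v)
  -- Parents are needed, since an empty block has norm 0. Without parents the left-hand blocks of
  -- A.2 have no rows either.
  have hnorm : ∀ v, (G.pa v).Nonempty → e ≤ α * ‖blk Sg (G.pa v) (G.pa v)‖ := by
    intro v hv
    have : Nonempty (G.pa v) := hv.to_subtype
    have h1 : ‖(1 : Matrix (G.pa v) (G.pa v) ℝ)‖ = 1 := CStarRing.norm_one
    have h2 := norm_sub_le (blk Sg (G.pa v) (G.pa v)) (blk Sg (G.pa v) (G.pa v) - 1)
    rw [sub_sub_cancel, h1] at h2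
    refine heα.trans ?_
    gcongr
    linarith [hE v]
  have hoff : ∀ v, ∀ A B : Finset (Fin n), Disjoint A B → A.card ≤ k ^ 2 → B.card ≤ k →
      (G.pa v = ∅ → A = ∅) → ‖blk Sg A B‖ ≤ α * ‖blk Sg (G.pa v) (G.pa v)‖ := by
    intro v A B hd hA hB hv
    rcases (G.pa v).eq_empty_or_nonempty with h | h
    · rw [hv h, norm_blk_of_isEmpty_left]
      positivity
    · rw [← blk_sub_one_of_disjoint Sg hd]
      exact (hS A B hA hB).trans (hnorm v h)
  refine ⟨fun v => isUnit_det_and_spectralCond_le he1 (hE v), ?_, ?_, ?_, ?_⟩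
  · exact fun v => hoff v _ _ (Finset.disjoint_singleton_right.2 (self_notMem_pa hG v))
      (hcard v) (by simpa using hk) id
  · exact fun v hv => hoff v _ _ hv (card_spa_le hG v) (hG.indegree_le v) spa_eq_empty_of_pa
  · refine fun v => hoff v _ _ Finset.sdiff_disjoint
      ((Finset.card_le_card Finset.sdiff_subset).trans (card_spa_le hG v)) (hG.indegree_le v)
      fun h => ?_
    rw [spa_eq_empty_of_pa h, Finset.empty_sdiff]
  · exact fun v => hoff v _ _ (Finset.disjoint_singleton_right.2 (self_notMem_spa hG v))
      (card_spa_le hG v) (by simpa using hk) spa_eq_empty_of_pa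

/-- The assumptions hold whenever the unit vectors are almost orthogonal and all weights on the
edges lie in their range. -/
theorem assumptions_of_almost_orthogonal (hk : 1 ≤ k) (hG : G.IsBowFree k) {μ : ℝ}
    (hμ : 10 * ((k : ℝ) + 1) ≤ μ) {L : Matrix (Fin n) (Fin n) ℝ}
    (hL0 : ∀ u v, ¬ G.dir u v → L u v = 0)
    (hL : ∀ u v, G.dir u v → |L u v| ≤ 1 / (2 * k * μ) ∧ 1 / (n : ℝ) ^ 2 ≤ |L u v|)
    {E : Type*} [NormedAddCommGroup E] [InnerProductSpace ℝ E] [FiniteDimensional ℝ E]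
    {x y : Fin n → E} (hy : ∀ i, ‖y i‖ = 1)
    (hyy : ∀ i j, i ≠ j → |inner ℝ (y i) (y j)| ≤ 1 / (80 * k ^ 2 * μ))
    (hxy : ∀ i, x i = ‖(Submodule.span ℝ {z | ∃ j ∈ G.pa i, z = x j})ᗮ.starProjection (y i)‖⁻¹ •
      (Submodule.span ℝ {z | ∃ j ∈ G.pa i, z = x j})ᗮ.starProjection (y i))
    {Sg : Matrix (Fin n) (Fin n) ℝ} (hSg : Sg = lsemCov L (Matrix.of fun i j => inner ℝ (x i) (x j)))
    {κ₀ : ℝ} (hκ : (1 + 1.7 * (1 / (2 * μ))) / (1 - 1.7 * (1 / (2 * μ))) ≤ κ₀) :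
    AssumptionA1 G Sg κ₀ ∧ AssumptionA2 G Sg (1 / μ) ∧
      AssumptionA3 G L (1 / μ) ((n : ℝ) ^ 2) := by
  have hk1 : (1 : ℝ) ≤ k := by exact_mod_cast hk
  have hμ0 : 0 < μ := by linarith
  set h := 1 / (2 * μ) with hh
  have hh0 : 0 < h := by positivity
  have hhμ : 1 / μ = 2 * h := by rw [hh]; field_simp
  have hhk : 20 * (k + 1) * h ≤ 1 := by
    rw [hh, mul_one_div, div_le_one (by positivity)]
    linarith
  have hh40 : 40 * h ≤ 1 := by nlinarith
  have hL' : ∀ u v, |L u v| ≤ h / k := by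
    intro u v
    by_cases huv : G.dir u v
    · refine (hL u v huv).1.trans (le_of_eq ?_)
      rw [hh]
      field_simp
    · rw [hL0 u v huv, abs_zero]
      positivity
  obtain ⟨hx, hxx⟩ := coherence_of_generated hk hG (by positivity) (by
    rw [mul_one_div, div_le_one (by positivity)]
    nlinarith [mul_nonneg (sub_nonneg.2 hk1) (by linarith : (0 : ℝ) ≤ k)]) hy hyy hxy
  have hW : ∀ i j, |((Matrix.of fun i j => inner ℝ (x i) (x j)) - 1 : Matrix (Fin n) (Fin n) ℝ) i j|
      ≤ h / (10 * k ^ 2) := by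
    intro i j
    rw [Matrix.sub_apply, Matrix.of_apply]
    rcases eq_or_ne i j with rfl | hij
    · rw [real_inner_self_eq_norm_sq, hx, Matrix.one_apply_eq]
      simp only [one_pow, sub_self, abs_zero]
      positivity
    · rw [Matrix.one_apply_ne hij, sub_zero]
      refine (hxx i j hij).trans (le_of_eq ?_)
      rw [hh]
      field_simp
      norm_num
  obtain ⟨h1, h2⟩ := assumptions_of_norm_blk_sub_one_le hk hG (Sg := Sg) (e := 1.7 * h)
    (α := 1 / μ) (by linarith) (by positivity) (by rw [hhμ]; nlinarith)
    (fun A B hA hB => hSg ▸ norm_blk_lsemCov_sub_one_le hk hG hh0.le hhk hL0 hL' hW hA hB)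
  refine ⟨fun v => ⟨(h1 v).1, (h1 v).2.trans hκ⟩, h2, fun v => ?_, fun u v huv => (hL u v huv).2⟩
  rw [hhμ]
  have := norm_blk_weights_le hk hG hh0.le hL0 hL' (G.spa v) (hG.indegree_le v)
  linarith

end MixedGraph

/-! ### Numerical conditions -/

section Constants

variable {μ : ℝ}

/-- With t = 1/μ, the left side is at most 1 + 4t, hence at most (1 + t)⁴ by Bernoulli; of the
second summand only nonnegativity matters. -/
theorem condition_bound_le (hμ : 20 ≤ μ) :
    (1 + 1.7 * (1 / (2 * μ))) / (1 - 1.7 * (1 / (2 * μ))) ≤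
      ((1 + μ) / μ) ^ 4 + (μ + 1) ^ 2 / (5 * μ ^ 2 * (μ - 1)) := by
  have h0 : 0 < μ := by linarith
  set t := 1 / μ with ht
  have ht0 : 0 < t := by positivity
  have ht1 : t ≤ 1 / 20 := one_div_le_one_div_of_le (by norm_num) hμ
  have h1 : 1 / (2 * μ) = t / 2 := by rw [ht]; field_simp
  have h2 : (1 + μ) / μ = 1 + t := by rw [ht]; field_simp; ring
  have h3 : 0 ≤ (μ + 1) ^ 2 / (5 * μ ^ 2 * (μ - 1)) :=
    div_nonneg (sq_nonneg _) (mul_nonneg (by positivity) (by linarith))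
  have h4 : 1 + 4 * t ≤ (1 + t) ^ 4 := by
    have := one_add_mul_le_pow (by linarith : (-2 : ℝ) ≤ t) 4
    exact_mod_cast this
  rw [h1, h2]
  refine le_trans ?_ (le_add_of_nonneg_right h3)
  refine le_trans ?_ h4
  rw [div_le_iff₀ (by linarith)]
  nlinarith

theorem condition_const_le (hμ : 20 ≤ μ) :
    ((1 + μ) / μ) ^ 4 + (μ + 1) ^ 2 / (5 * μ ^ 2 * (μ - 1)) ≤ 1.24 := by
  have h0 : 0 < μ := by linarith
  have h2 : (1 + μ) / μ ≤ 1.05 := by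
    rw [div_le_iff₀ h0]
    linarith
  have h3 : (μ + 1) ^ 2 / (5 * μ ^ 2 * (μ - 1)) ≤ 0.02 := by
    rw [div_le_iff₀ (mul_pos (by positivity) (by linarith))]
    nlinarith [mul_nonneg (sub_nonneg.2 hμ) (sq_nonneg μ)]
  have h4 : ((1 + μ) / μ) ^ 4 ≤ 1.05 ^ 4 := by gcongr
  norm_num at h4 h3 ⊢
  linarith

theorem constantsAdmissible {n k : ℕ} (hn : 2 ≤ n) (hk : 1 ≤ k) (hμ : 10 * ((k : ℝ) + 1) ≤ μ)
    {κ₀ : ℝ} (hκ0 : 0 ≤ κ₀) (hκ : κ₀ ≤ 1.24) :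
    ConstantsAdmissible n k (1 / μ) (1 / μ) κ₀ := by
  have hk1 : (1 : ℝ) ≤ k := by exact_mod_cast hk
  have hn2 : (2 : ℝ) ≤ n := by exact_mod_cast hn
  have hμ20 : 20 ≤ μ := by linarith
  have h0 : 0 < μ := by linarith
  set t := 1 / μ with ht
  have ht0 : 0 < t := by positivity
  have ht1 : t ≤ 1 / 20 := one_div_le_one_div_of_le (by norm_num) hμ20
  have htk : 10 * (k + 1) * t ≤ 1 := by
    rw [ht, mul_one_div, div_le_one h0]
    exact hμ
  have hq : t * t * κ₀ ≤ 0.0031 := by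
    calc t * t * κ₀ ≤ 1 / 20 * (1 / 20) * 1.24 := by gcongr
      _ = _ := by norm_num
  have hq0 : 0 ≤ t * t * κ₀ := by positivity
  refine ⟨ht0, by linarith, by linarith, ?_, by linarith, ?_⟩
  · intro γ hγ hγn
    have h1 : (2 : ℝ) ^ 4 ≤ (n : ℝ) ^ 4 := by gcongr
    have h2 : γ * (n : ℝ) ^ 4 < 1 := (lt_div_iff₀ (by positivity)).1 hγn
    rw [le_div_iff₀ (by positivity)]
    nlinarith
  · set q := t * t * κ₀
    have hq1 : 0 < 1 - q := by linarith
    -- The two bounds give 1.25 · 2.32 · t = 2.9t, and kt < 1/10.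
    have h1 : t * κ₀ / (1 - q) ≤ 1.25 * t := by
      rw [div_le_iff₀ hq1]
      nlinarith
    have h2 : κ₀ * (1 + t) / (1 - q) ≤ 1.32 := by
      rw [div_le_iff₀ hq1]
      nlinarith
    calc _ ≤ 1.25 * t * (1 + 1.32) := by gcongr
      _ < 0.99 / k := by
        rw [lt_div_iff₀ (by linarith)]
        nlinarith

end Constants

/-! ### Exceptional events -/

section Probability

/-- Almost surely all weights lie in their range. -/
theorem IsRandomWeights.measure_not_mem_range {n k : ℕ} {G : MixedGraph n} {μ : ℝ} {S : Type*}
    [MeasurableSpace S] {P : Measure S} {L : S → Matrix (Fin n) (Fin n) ℝ}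
    (hL : IsRandomWeights G k μ P L) {u v : Fin n} (huv : G.dir u v) :
    P {ω | ¬ (|L ω u v| ≤ 1 / (2 * k * μ) ∧ 1 / (n : ℝ) ^ 2 ≤ |L ω u v|)} = 0 := by
  set s := Set.Icc (-(1 / (2 * k * μ))) (1 / (2 * k * μ)) \
    Set.Icc (-(1 / (n : ℝ) ^ 2)) (1 / (n : ℝ) ^ 2) with hs
  have hsm : MeasurableSet s := measurableSet_Icc.diff measurableSet_Icc
  have h1 : P ((fun ω => L ω u v) ⁻¹' sᶜ) = 0 := by
    rw [← Measure.map_apply (hL.measurable u v) hsm.compl,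
      show P.map (fun ω => L ω u v) = _ from hL.uniform_of_edge u v huv, cond_apply hsm]
    simp
  refine measure_mono_null (Set.compl_subset_compl.2 fun ω hmem => ?_) h1
  have hmem' : L ω u v ∈ s := hmem
  rw [hs, Set.mem_sdiff, Set.mem_Icc, Set.mem_Icc, ← abs_le, ← abs_le, not_le] at hmem'
  exact ⟨hmem'.1, hmem'.2.le⟩

/-- A union bound over pairs of indices. -/
theorem measure_iUnion_pairs_le {n : ℕ} {S : Type*} [MeasurableSpace S] (P : Measure S)
    (s : Fin n → Fin n → Set S) {ε : ENNReal} (hs : ∀ i j, P (s i j) ≤ ε) :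
    P (⋃ i, ⋃ j, s i j) ≤ (n : ENNReal) ^ 2 * ε := by
  calc _ ≤ ∑ i, P (⋃ j, s i j) := measure_iUnion_fintype_le _ _
    _ ≤ ∑ i, ∑ j, P (s i j) := Finset.sum_le_sum fun i _ => measure_iUnion_fintype_le _ _
    _ ≤ ∑ _i : Fin n, ∑ _j : Fin n, ε := by gcongr with i _ j _; exact hs i j
    _ = _ := by simp [sq, mul_assoc]

/-- `d ≥ a log⁴ n` makes `n² exp (-b d)` smaller than every inverse power of `n`. -/
theorem eventually_sq_mul_exp_le {a b : ℝ} (ha : 0 < a) (hb : 0 < b) (c : ℕ) :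
    ∀ᶠ n : ℕ in atTop, ∀ d : ℝ, a * Real.log n ^ 4 ≤ d →
      (n : ℝ) ^ 2 * (2 * Real.exp (-(b * d))) ≤ 1 / (n : ℝ) ^ c := by
  have hlog : Tendsto (fun n : ℕ => Real.log n) atTop atTop :=
    Real.tendsto_log_atTop.comp tendsto_natCast_atTop_atTop
  filter_upwards [hlog.eventually_ge_atTop 1, hlog.eventually_ge_atTop ((c + 3) / (a * b)),
    eventually_ge_atTop 2] with n h1 h2 hn d hd
  have hn0 : (0 : ℝ) < n := by exact_mod_cast (by omega : 0 < n)
  have hn2 : (2 : ℝ) ≤ n := by exact_mod_cast hn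
  set l := Real.log n with hl
  have h3 : (c + 3 : ℝ) * l ≤ b * d := by
    rw [div_le_iff₀ (by positivity)] at h2
    calc (c + 3 : ℝ) * l ≤ l * (a * b) * l := by gcongr
      _ = a * b * l ^ 2 := by ring
      _ ≤ a * b * l ^ 4 := by
        gcongr
        norm_num
      _ = b * (a * l ^ 4) := by ring
      _ ≤ b * d := by gcongr
  have h4 : Real.exp (-(b * d)) ≤ 1 / (n : ℝ) ^ (c + 3) := by
    calc _ ≤ Real.exp (-((c + 3 : ℝ) * l)) := by gcongr
      _ = _ := by
        rw [Real.exp_neg, one_div, show (c + 3 : ℝ) * l = ((c + 3 : ℕ) : ℝ) * l by push_cast; ring,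
          Real.exp_nat_mul, hl, Real.exp_log hn0]
  -- The exponent c + 3 absorbs n² from the pairs and one further n ≥ 2 for the factor 2.
  calc _ ≤ (n : ℝ) ^ 2 * (n * (1 / (n : ℝ) ^ (c + 3))) := by gcongr
    _ = _ := by
      rw [pow_add]
      field_simp

end Probability

/-- `C` is the implied constant in `d ≥ Θ(k⁸ log⁴ n)`. The sequences `α` and `κ₀` depend only on
`k`, `μ` and `C`; the failure probability is smaller than every inverse power of `n`. -/
theorem mainTheorem3 (k : ℕ) (hk : 1 ≤ k) (μ : ℝ) (hμ : 10 * ((k : ℝ) + 1) ≤ μ)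
    (C : ℝ) (hC : 0 < C) :
    ∃ α κ₀ : ℕ → ℝ,
      Tendsto α atTop (𝓝 (1 / μ)) ∧
      Tendsto κ₀ atTop
        (𝓝 (((1 + μ) / μ) ^ 4 + (μ + 1) ^ 2 / (5 * μ ^ 2 * (μ - 1)))) ∧
      ∀ c : ℕ, ∃ N : ℕ, ∀ n : ℕ, N ≤ n →
        ConstantsAdmissible n k (α n) (1 / μ) (κ₀ n) ∧
        ∀ d : ℕ, C * (k : ℝ) ^ 8 * Real.log n ^ 4 ≤ d →
        ∀ G : MixedGraph n, G.IsBowFree k →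
        ∀ (S : Type*) [MeasurableSpace S] (P : Measure S) [IsProbabilityMeasure P]
          (L : S → Matrix (Fin n) (Fin n) ℝ)
          (x : Fin n → S → EuclideanSpace ℝ (Fin d)),
          IsRandomWeights G k μ P L → IsRandomVectors G P x →
          P {ω | ¬ (AssumptionA1 G (lsemCov (L ω) (gramMat fun i => x i ω)) (κ₀ n) ∧
                    AssumptionA2 G (lsemCov (L ω) (gramMat fun i => x i ω)) (α n) ∧
                    AssumptionA3 G (L ω) (1 / μ) ((n : ℝ) ^ 2))}
            ≤ ENNReal.ofReal (1 / (n : ℝ) ^ c)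
    := by
  have hk1 : (1 : ℝ) ≤ k := by exact_mod_cast hk
  have hμ20 : 20 ≤ μ := by linarith
  have hμ0 : 0 < μ := by linarith
  refine ⟨fun _ => 1 / μ, fun _ => ((1 + μ) / μ) ^ 4 + (μ + 1) ^ 2 / (5 * μ ^ 2 * (μ - 1)),
    tendsto_const_nhds, tendsto_const_nhds, fun c => ?_⟩
  -- Chosen so that 4δ = h/(10k²) with h = 1/(2μ), the noise level allowed in the perturbation
  -- bound.
  set δ := 1 / (80 * (k : ℝ) ^ 2 * μ) with hδ
  have hδ0 : 0 < δ := by positivity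
  have hδ1 : δ ≤ 1 / 2 := by
    apply one_div_le_one_div_of_le (by norm_num)
    nlinarith [one_le_pow₀ (n := 2) hk1]
  have hδ2 : δ ^ 2 ≤ 1 / 2 := by nlinarith
  have hev := (eventually_sq_mul_exp_le (a := C * (k : ℝ) ^ 8) (b := δ ^ 2 / 2) (by positivity)
    (by positivity) c).and (eventually_ge_atTop 2)
  obtain ⟨N, hN⟩ := eventually_atTop.1 hev
  refine ⟨N, fun n hn => ?_⟩
  obtain ⟨hexp, hn2⟩ := hN n hn
  have hκ0 : 0 ≤ ((1 + μ) / μ) ^ 4 + (μ + 1) ^ 2 / (5 * μ ^ 2 * (μ - 1)) :=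
    add_nonneg (by positivity) (div_nonneg (sq_nonneg _) (mul_nonneg (by positivity) (by linarith)))
  refine ⟨constantsAdmissible hn2 hk hμ hκ0 (condition_const_le hμ20), ?_⟩
  intro d hd G hG S _ P _ L x hL hx
  obtain ⟨y, hym, hyu, hyi, hxy⟩ := hx.generated
  have hd0 : 0 < d := by
    have hlog : 0 < Real.log n := Real.log_pos (by exact_mod_cast hn2)
    have : (0 : ℝ) < d := lt_of_lt_of_le (by positivity) hd
    exact_mod_cast this
  have : Nontrivial (EuclideanSpace ℝ (Fin d)) := by
    apply Module.nontrivial_of_finrank_pos (R := ℝ)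
    simpa using hd0
  let bad : Fin n → Fin n → Set S := fun i j =>
    {ω | i ≠ j ∧ δ < |inner ℝ (y i ω : EuclideanSpace ℝ (Fin d)) (y j ω)|} ∪
    {ω | G.dir i j ∧ ¬ (|L ω i j| ≤ 1 / (2 * k * μ) ∧ 1 / (n : ℝ) ^ 2 ≤ |L ω i j|)}
  have hbad : ∀ i j, P (bad i j) ≤ ENNReal.ofReal (2 * Real.exp (-(δ ^ 2 / 2 * d))) := by
    intro i j
    have h1 : P {ω | i ≠ j ∧ δ < |inner ℝ (y i ω : EuclideanSpace ℝ (Fin d)) (y j ω)|} ≤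
        ENNReal.ofReal (2 * Real.exp (-(δ ^ 2 / 2 * d))) := by
      by_cases hij : i = j
      · simp [hij]
      · refine (measure_mono fun ω hω => hω.2).trans ((measure_abs_inner_gt_le volume P (hym i)
          (hym j) (hyi.indepFun hij) (hyu j) hδ0.le hδ2).trans (le_of_eq ?_))
        rw [finrank_euclideanSpace_fin]
        congr 4
        ring
    have h2 : P {ω | G.dir i j ∧
        ¬ (|L ω i j| ≤ 1 / (2 * k * μ) ∧ 1 / (n : ℝ) ^ 2 ≤ |L ω i j|)} = 0 := by
      by_cases hij : G.dir i j
      · exact measure_mono_null (fun ω hω => hω.2) (hL.measure_not_mem_range hij)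
      · simp [hij]
    calc _ ≤ _ := measure_union_le _ _
      _ ≤ _ := by rw [h2, add_zero]; exact h1
  -- Off the union of the bad events the deterministic result applies, so the failure event is
  -- contained in it; monotonicity needs no measurability of that event.
  calc _ ≤ P (⋃ i, ⋃ j, bad i j) := by
        refine measure_mono fun ω hω => ?_
        by_contra hgood
        simp only [Set.mem_iUnion, not_exists] at hgood
        refine hω (MixedGraph.assumptions_of_almost_orthogonal hk hG hμ
          (hL.zero_of_not_edge ω) (fun u v huv => ?_) (x := fun i => x i ω)
          (y := fun i => (y i ω : EuclideanSpace ℝ (Fin d))) (fun i => by simp)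
          (fun i j hij => ?_) (fun i => hxy i ω) rfl (condition_bound_le hμ20))
        · by_contra h
          exact hgood u v (Or.inr ⟨huv, h⟩)
        · by_contra h
          exact hgood i j (Or.inl ⟨hij, not_le.1 h⟩)
    _ ≤ (n : ENNReal) ^ 2 * ENNReal.ofReal (2 * Real.exp (-(δ ^ 2 / 2 * d))) :=
        measure_iUnion_pairs_le P bad hbad
    _ = ENNReal.ofReal ((n : ℝ) ^ 2 * (2 * Real.exp (-(δ ^ 2 / 2 * d)))) := by
        rw [ENNReal.ofReal_mul (p := (n : ℝ) ^ 2) (by positivity), ENNReal.ofReal_pow (by positivity),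
          ENNReal.ofReal_natCast]
    _ ≤ _ := ENNReal.ofReal_le_ofReal (hexp d hd)
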